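/- Let $d\ge 1$ and let $\mathbb{T}^2=\mathbb{C}/(\mathbb{Z}\oplus\mathbb{Z}i)$. A \emph{$d$-symmetric differential over $\mathbb{T}^2$} is a compact connected Riemann surface $X$ with a holomorphic $1$-form $\omega$ and two distinct named points $p_0,p_1$ such that $\omega$ has zeros of order exactly $d-1$ at $p_0$ and $p_1$ and no other zeros (for $d=1$ the points $p_0,p_1$ are marked points), the group of automorphisms of $X$ preserving $\omega$ contains $\mathbb{Z}/d\mathbb{Z}$, the lattice of absolute periods of $\omega$ is $\mathbb{Z}\oplus\mathbb{Z}i$, and the natural projection $\pi:X\to\mathbb{T}^2$ with $\omega=\pi^*dz$, $\pi(p_0)=[0]$, has degree $d$. For $v\in\mathbb{C}\setminus(\mathbb{Z}\oplus\mathbb{Z}i)$ let $\#^d_v\mathbb{T}^2$ be the $d$-symmetric differential obtained from $d$ copies of $\mathbb{T}^2$, indexed by $\mathbb{Z}/d\mathbb{Z}$, by cutting them along the projection of the segment $[0,v]$ and regluing cyclically: when a path crosses the projected segment from left to right, the index of the sheet increases by the number of times the segment passes through the crossing point. The named cone points lie over $[0]$ and $[v]$. For an integer $i$ (only $i \bmod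 d$ matters) let $\mathscr{C}_i$ be the set of $d$-symmetric differentials isomorphic to $\#^d_v\mathbb{T}^2$ for some $v$ with $i<\operatorname{Im}v<i+1$, and let $\partial^{btm}\mathscr{C}_i$ be the set of those isomorphic to $\#^d_v\mathbb{T}^2$ for some $v\notin\mathbb{Z}\oplus\mathbb{Z}i$ with $\operatorname{Im}v=i$. (These are the horizontal cylinders, and their bottom boundary components, of the modular fiber $(\mathbb{R}^2/d\mathbb{Z}^2)\setminus(\mathbb{Z}^2/d\mathbb{Z}^2)$ parametrizing $d$-symmetric differentials over $\mathbb{T}^2$.) A cylinder of width $w$ of the horizontal foliation of $(X,\omega)$ is a maximal open subset of $X\setminus\{p_0,p_1\}$ of the form $\phi(\mathbb{R}/w\mathbb{Z}\times(0,h))$, where $h>0$ and $\phi$ is a holomorphic embedding with $\phi^*\omega=dz$. Write $(a,b)$ for the greatest common divisor, with $(0,d)=d$. \textbf{Theorem.} Let $(X,\omega)$ be a $d$-symmetric differential over $\mathbb{T}^2$. (1) If $(X,\omega)\in\mathscr{C}_i$, then the set of cylinders of the horizontal foliation of $(X,\omega)$ is the disjoint union of a set of $(i,d)$ cylinders of width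 $\frac{d}{(i,d)}$ and a set of $(i+1,d)$ cylinders of width $\frac{d}{(i+1,d)}$. (2) If $(X,\omega)\in\partial^{btm}\mathscr{C}_i$, then the horizontal foliation of $(X,\omega)$ has exactly $(i,d)$ cylinders, all of width $\frac{d}{(i,d)}$. -/

import Mathlib

open scoped Manifold Topology

noncomputable section

namespace DSym

/-- The lattice `ℤ ⊕ ℤ i` in `ℂ`. -/
def gaussLattice : AddSubgroup ℂ := AddSubgroup.closure {1, Complex.I}

/-- The base torus `𝕋² = ℂ / (ℤ ⊕ ℤ i)`. -/
abbrev Torus : Type := ℂ ⧸ gaussLattice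

/-- The projection `ℂ → 𝕋²`. -/
def toTorus (z : ℂ) : Torus := QuotientAddGroup.mk z

/-! ### Riemann surfaces with a 1-form -/

section Differentials

variable {X : Type*} [TopologicalSpace X] [ChartedSpace ℂ X]

/-- A field of complex linear forms on the tangent spaces of the Riemann surface `X`
(a form of type `(1,0)`).  Holomorphy is imposed separately: it follows from
`IsPullback` below. -/
abbrev OneForm (X : Type*) [TopologicalSpace X] [ChartedSpace ℂ X] : Type _ :=
  (x : X) → (TangentSpace 𝓘(ℂ, ℂ) x →L[ℂ] ℂ)

/-- `ω = π^* dz`: near every point of `X` the map `π : X → 𝕋²` has a holomorphic lift `F` to `ℂ`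
with `dF = ω`. -/
def IsPullback (ω : OneForm X) (π : X → Torus) : Prop :=
  ∀ x : X, ∃ F : X → ℂ, ∀ᶠ y in 𝓝 x,
    toTorus (F y) = π y ∧ HasMFDerivAt 𝓘(ℂ, ℂ) 𝓘(ℂ, ℂ) F y (ω y)

/-- `π` is the natural projection `X → 𝕋²`, `ω = π^* dz`, normalized by `π p₀ = 0`. -/
def IsNaturalProjection (ω : OneForm X) (p₀ : X) (π : X → Torus) : Prop :=
  IsPullback ω π ∧ π p₀ = 0

/-- The order of vanishing of `ω` at `x`, i.e. that of the function `c` in the local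
expression `ω = c(z) dz`. -/
def ordAt (ω : OneForm X) (x : X) : ℕ∞ :=
  analyticOrderAt
    (fun z : ℂ => (ω ((chartAt ℂ x).symm z)
      (mfderiv 𝓘(ℂ, ℂ) 𝓘(ℂ, ℂ) (chartAt ℂ x).symm z (1 : ℂ)) : ℂ))
    (chartAt ℂ x x)

/-- `g` is an automorphism of `(X, ω)`: `g` is holomorphic and `g^* ω = ω`. -/
def IsAut (ω : OneForm X) (g : X ≃ₜ X) : Prop :=
  MDifferentiable 𝓘(ℂ, ℂ) 𝓘(ℂ, ℂ) g ∧
    ∀ x : X, ∀ u : TangentSpace 𝓘(ℂ, ℂ) x,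
      ω (g x) (mfderiv 𝓘(ℂ, ℂ) 𝓘(ℂ, ℂ) g x u) = ω x u

/-- The lattice of absolute periods of `ω`, generated by the integrals of `ω` over closed
`C¹` curves. -/
def periodLattice (ω : OneForm X) : AddSubgroup ℂ :=
  AddSubgroup.closure
    {a : ℂ | ∃ γ : ℝ → X, ContMDiff 𝓘(ℝ, ℝ) 𝓘(ℝ, ℂ) 1 γ ∧ γ 0 = γ 1 ∧
      a = ∫ t in (0 : ℝ)..1,
        (ω (γ t) (show TangentSpace 𝓘(ℂ, ℂ) (γ t) from
          (mfderiv 𝓘(ℝ, ℝ) 𝓘(ℝ, ℂ) γ t (1 : ℝ))) : ℂ)}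

/-- `(X, ω)`, with named cone points `p₀, p₁`, is a `d`-symmetric differential covering
`𝕋² = ℂ / (ℤ ⊕ ℤ i)`.  For `d = 1` the points `p₀, p₁` are just marked points. -/
structure IsDSymmetric (d : ℕ) (ω : OneForm X) (p₀ p₁ : X) : Prop where
  /-- there are exactly two zeros, both of order `d - 1` -/
  ne : p₀ ≠ p₁
  ord_left : ordAt ω p₀ + 1 = d
  ord_right : ordAt ω p₁ + 1 = d
  ne_zero : ∀ x : X, x ≠ p₀ → x ≠ p₁ → ω x ≠ 0
  /-- `ℤ/dℤ` is contained in the automorphism group -/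
  aut : ∃ g : X ≃ₜ X, IsAut ω g ∧ orderOf g = d
  /-- the period lattice is `ℤ ⊕ ℤ i` -/
  periods : periodLattice ω = gaussLattice
  /-- the natural projection has degree `d` -/
  degree : ∃ π : X → Torus, IsNaturalProjection ω p₀ π ∧
    ∀ t : Torus, t ≠ π p₀ → t ≠ π p₁ → Nat.card (π ⁻¹' {t}) = d

/-! ### Horizontal cylinders -/

/-- The open horizontal strip `ℝ × (0, h)`. -/
def strip (h : ℝ) : Set ℂ := {z : ℂ | 0 < z.im ∧ z.im < h}

/-- `C` is an open horizontal cylinder of (core) width `w` in `(X, ω)` that avoids the singular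
set `S`: it is the image of an embedding of `ℝ/wℤ × (0, h)` which pulls `ω` back to `dz`.  The
embedding is written as a `w`-periodic map `Φ` on the strip `ℝ × (0, h)`. -/
def IsCylinder (ω : OneForm X) (S : Set X) (w : ℝ) (C : Set X) : Prop :=
  0 < w ∧ ∃ (h : ℝ) (Φ : ℂ → X), 0 < h ∧
    MDifferentiableOn 𝓘(ℂ, ℂ) 𝓘(ℂ, ℂ) Φ (strip h) ∧
    (∀ z ∈ strip h, Φ z ∉ S) ∧
    (∀ z ∈ strip h, ω (Φ z) (mfderiv 𝓘(ℂ, ℂ) 𝓘(ℂ, ℂ) Φ z (1 : ℂ)) = 1) ∧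
    (∀ z ∈ strip h, ∀ z' ∈ strip h, Φ z = Φ z' ↔ ∃ n : ℤ, z' = z + n * w) ∧
    C = Φ '' strip h

/-- `C` is a cylinder of width `w` of the horizontal foliation of `(X, ω)`, that is, a maximal
open horizontal cylinder. -/
def IsMaxCylinder (ω : OneForm X) (S : Set X) (w : ℝ) (C : Set X) : Prop :=
  IsCylinder ω S w C ∧ ∀ (w' : ℝ) (C' : Set X), IsCylinder ω S w' C' → C ⊆ C' → C' = C

/-- The set of all cylinders of the horizontal foliation of `(X, ω)`. -/
def horizontalCylinders (ω : OneForm X) (S : Set X) : Set (Set X) :=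
  {C | ∃ w : ℝ, IsMaxCylinder ω S w C}

end Differentials

/-! ### The connected sum `#^d_v 𝕋²` -/

/-- The number of times that the segment `[0, v]`, projected to `𝕋²`, passes through `t`. -/
def passes (v : ℂ) (t : Torus) : ℕ :=
  Nat.card {s : ℝ // s ∈ Set.Icc (0 : ℝ) 1 ∧ toTorus (s * v) = t}

/-- The points of `#^d_v 𝕋²` without its cone points: `d` copies of `𝕋² - {[0], [v]}`, indexed
by `ℤ/dℤ`.  The copies are cut along the projection of `[0, v]` and glued cyclically; this is
expressed by the topology below. -/
@[ext]
structure SlitSum (d : ℕ) (v : ℂ) where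
  base : Torus
  base_ne_zero : base ≠ 0
  base_ne : base ≠ toTorus v
  sheet : ZMod d

/-- The change of sheet when one moves from a point over `t` by a small vector `u`: it is zero
if `u` points to the left of the segment `[0, v]` or along it, and the sheet index grows by one
for each passage of the segment through `t` if `u` points to its right.  (A point on the slit is
counted to the left side.) -/
def jump (d : ℕ) (v : ℂ) (t : Torus) (u : ℂ) : ZMod d :=
  if (u * (starRingEnd ℂ) v).im < 0 then (passes v t : ZMod d) else 0

/-- The topology obtained by the gluing: a neighbourhood of a point over `t` on sheet `k` consists
of the points over `t + u`, `u` small, on the sheet `k + jump d v t u`. -/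
instance (d : ℕ) (v : ℂ) : TopologicalSpace (SlitSum d v) where
  IsOpen U := ∀ x ∈ U, ∃ ε : ℝ, 0 < ε ∧ ∀ (u : ℂ) (y : SlitSum d v), ‖u‖ < ε →
    y.base = x.base + toTorus u → y.sheet = x.sheet + jump d v x.base u → y ∈ U
  isOpen_univ := fun _ _ => ⟨1, one_pos, fun _ _ _ _ _ => Set.mem_univ _⟩
  isOpen_inter := by
    intro U V hU hV x hx
    obtain ⟨a, ha, hUa⟩ := hU x hx.1
    obtain ⟨b, hb, hVb⟩ := hV x hx.2
    exact ⟨min a b, lt_min ha hb, fun u y hu h1 h2 =>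
      ⟨hUa u y (hu.trans_le (min_le_left _ _)) h1 h2,
        hVb u y (hu.trans_le (min_le_right _ _)) h1 h2⟩⟩
  isOpen_sUnion := by
    intro s hs x hx
    obtain ⟨U, hU, hxU⟩ := hx
    obtain ⟨a, ha, h⟩ := hs U hU x hxU
    exact ⟨a, ha, fun u y hu h1 h2 => ⟨U, hU, h u y hu h1 h2⟩⟩

section ModularFiber

variable {X : Type*} [TopologicalSpace X] [ChartedSpace ℂ X]

/-- `(X, ω)`, with named cone points `p₀, p₁` over `[0], [v]`, is isomorphic to the nondegenerate
differential `#^d_v (𝕋², dz)`, `v ∉ ℤ ⊕ ℤ i`: away from the cone points `X` is homeomorphic to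
`SlitSum d v` over `𝕋²`, and `ω` is the pullback of `dz` from `𝕋²`. -/
def IsConnectedSum (d : ℕ) (v : ℂ) (ω : OneForm X) (p₀ p₁ : X) : Prop :=
  v ∉ gaussLattice ∧ ∃ π : X → Torus, IsNaturalProjection ω p₀ π ∧ π p₁ = toTorus v ∧
    ∃ f : {x : X // x ≠ p₀ ∧ x ≠ p₁} ≃ₜ SlitSum d v, ∀ x, (f x).base = π x

/-- `(X, ω)` lies in the open horizontal cylinder `𝒞_i` of the modular fiber
`{[#^d_v 𝕋²]} = ℂ/d(ℤ ⊕ ℤ i) - (ℤ ⊕ ℤ i)/d(ℤ ⊕ ℤ i)`: it is `#^d_v 𝕋²` for some `v` with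
`i < Im v < i + 1`. -/
def InFiberCylinder (d : ℕ) (i : ℤ) (ω : OneForm X) (p₀ p₁ : X) : Prop :=
  ∃ v : ℂ, (i : ℝ) < v.im ∧ v.im < i + 1 ∧ IsConnectedSum d v ω p₀ p₁

/-- `(X, ω)` lies in the bottom boundary component of `𝒞_i`: it is `#^d_v 𝕋²` for some `v` with
`Im v = i`. -/
def InFiberCylinderBottom (d : ℕ) (i : ℤ) (ω : OneForm X) (p₀ p₁ : X) : Prop :=
  ∃ v : ℂ, v.im = i ∧ IsConnectedSum d v ω p₀ p₁

end ModularFiber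

end DSym

end

/-!
Away from the cone points, `X` is a cyclic covering of the torus minus `[0]` and `[v]`.  The
horizontal circles of the torus at the heights of `[0]` and `[v]` cut it into one or two annuli, and
the cylinders of `X` are the components of the preimages of these annuli.  A horizontal circle in an
annulus whose heights `y ∈ (0, 1)` satisfy `⌊y - Im v⌋ = -κ` crosses the slit `κ` times, so it raises
the sheet by `κ`.  The components over the annulus therefore correspond to the cosets of the subgroup
generated by `κ` in `ℤ/dℤ`, of which there are `(κ, d)`, and the width of each is the order
`d / (κ, d)` of `κ`.  Nonempty annuli occur for `κ = i` and `κ = i + 1` if `i < Im v < i + 1`, and only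
for `κ = i` if `Im v = i`.

The annuli are handled through their preimages in `ℂ`, the horizontal bands `band v κ`.  The function
`sheetShift` counts crossings of the slit along a band; by `eventually_sheetShift_add` it changes as
the sheets of `SlitSum d v` do, so that it defines continuous lifts `bandLift` of the band with open
images, and by `sheetShift_add_intCast` it has monodromy `κ`.  Transported to `X`, these lifts are
holomorphic with `ω` pulled back to `dz`, because a local primitive of `ω` inverts them
(`IsPullback.mdifferentiableAt_of_lift`).  Conversely every horizontal cylinder covers a translation
of the torus (`IsPullback.exists_lift`); its closed leaves cover whole horizontal circles, so they
cannot lie at the height of `[0]` or `[v]`, and the cylinder is contained in the image of one of the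
lifts (`IsCylinder.subset_bandCylinder`).  These images are pairwise equal or disjoint, hence they
are exactly the maximal cylinders.
-/

namespace DSym

/-! ### The Gaussian lattice and the torus -/

lemma mem_gaussLattice_iff {z : ℂ} :
    z ∈ gaussLattice ↔ ∃ m n : ℤ, z = m + n * Complex.I := by
  simp only [gaussLattice, AddSubgroup.mem_closure_pair, zsmul_eq_mul, mul_one]
  exact exists_congr fun m => exists_congr fun n => eq_comm

lemma toTorus_eq_iff {z w : ℂ} :
    toTorus z = toTorus w ↔ ∃ m n : ℤ, w = z + m + n * Complex.I := by
  rw [toTorus, toTorus, QuotientAddGroup.eq, mem_gaussLattice_iff]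
  refine exists_congr fun m => exists_congr fun n => ?_
  rw [neg_add_eq_iff_eq_add, add_assoc]

lemma toTorus_add (z w : ℂ) : toTorus (z + w) = toTorus z + toTorus w := rfl

lemma toTorus_eq_zero_iff {z : ℂ} :
    toTorus z = 0 ↔ ∃ m n : ℤ, z = m + n * Complex.I := by
  rw [eq_comm, show (0 : Torus) = toTorus 0 from rfl, toTorus_eq_iff]
  simp

lemma toTorus_surjective : Function.Surjective toTorus := QuotientAddGroup.mk_surjective

lemma eq_of_toTorus_eq_of_norm_sub_lt {z w : ℂ} (h : toTorus z = toTorus w)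
    (hn : ‖w - z‖ < 1) : z = w := by
  obtain ⟨m, n, rfl⟩ := toTorus_eq_iff.1 h
  have hre := (Complex.abs_re_le_norm _).trans_lt hn
  have him := (Complex.abs_im_le_norm _).trans_lt hn
  simp only [Complex.sub_re, Complex.add_re, Complex.intCast_re, Complex.mul_re, Complex.I_re,
    mul_zero, Complex.intCast_im, Complex.I_im, mul_one, sub_self, add_zero, add_sub_cancel_left,
    Complex.sub_im, Complex.add_im, Complex.mul_im] at hre him
  have hm : m = 0 := Int.abs_lt_one_iff.1 (by exact_mod_cast hre)
  have hn : n = 0 := Int.abs_lt_one_iff.1 (by exact_mod_cast him)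
  simp [hm, hn]

/-! ### Flat coordinates -/

section Coordinates

variable {X : Type*} [TopologicalSpace X] [ChartedSpace ℂ X]

/-- Along a continuous map that covers a translation `z ↦ [z + c]` of the torus, a local primitive
of `ω` is a left inverse up to a constant, so the map is holomorphic and pulls `ω` back to `dz`
wherever `ω` does not vanish. -/
lemma IsPullback.mdifferentiableAt_of_lift {ω : OneForm X} {π : X → Torus}
    (hπ : IsPullback ω π) {Φ : ℂ → X} {z₀ c : ℂ} (hΦ : ContinuousAt Φ z₀)
    (h : ∀ᶠ z in 𝓝 z₀, π (Φ z) = toTorus (z + c)) (h0 : ω (Φ z₀) ≠ 0) :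
    MDifferentiableAt 𝓘(ℂ, ℂ) 𝓘(ℂ, ℂ) Φ z₀ ∧
      ω (Φ z₀) (mfderiv 𝓘(ℂ, ℂ) 𝓘(ℂ, ℂ) Φ z₀ (1 : ℂ)) = (1 : ℂ) := by
  obtain ⟨F, hF⟩ := hπ (Φ z₀)
  have hF0 : HasMFDerivAt 𝓘(ℂ, ℂ) 𝓘(ℂ, ℂ) F (Φ z₀) (ω (Φ z₀)) := hF.self_of_nhds.2
  -- the difference of the two lifts is continuous at `z₀` with values in a discrete set
  have hloc : ∀ᶠ z in 𝓝 z₀, F (Φ z) = z + (F (Φ z₀) - z₀) := by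
    have hcont : ContinuousAt (fun z => F (Φ z) - z - (F (Φ z₀) - z₀)) z₀ :=
      ((hF0.continuousAt.comp hΦ).sub continuousAt_id).sub continuousAt_const
    have hsmall : ∀ᶠ z in 𝓝 z₀, ‖F (Φ z) - z - (F (Φ z₀) - z₀)‖ < 1 := by
      have := hcont.norm
      refine this.eventually_lt continuousAt_const ?_
      simp
    filter_upwards [hsmall, h, hΦ.eventually hF] with z hz hπz hFz
    have h1 : toTorus (F (Φ z)) = toTorus (z + c) := hFz.1.trans hπz
    have h2 : toTorus (F (Φ z₀)) = toTorus (z₀ + c) :=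
      hF.self_of_nhds.1.trans h.self_of_nhds
    refine (eq_of_toTorus_eq_of_norm_sub_lt ?_ ?_).symm
    · rw [show z + (F (Φ z₀) - z₀) = F (Φ z₀) + (z - z₀) by ring, toTorus_add, h1, h2,
        ← toTorus_add]
      congr 1; ring
    · rwa [← sub_sub]
  set e := extChartAt 𝓘(ℂ, ℂ) (Φ z₀)
  obtain ⟨L, hL⟩ : ∃ L : ℂ →L[ℂ] ℂ, L = ω (Φ z₀) := ⟨_, rfl⟩
  have hd : HasFDerivAt (F ∘ e.symm) L (e (Φ z₀)) := by
    rw [← hasFDerivWithinAt_univ, ← ModelWithCorners.range_eq_univ 𝓘(ℂ, ℂ), hL]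
    exact hF0.2
  have hdd : HasDerivAt (fun w => F (e.symm w) - (F (Φ z₀) - z₀)) (L 1) (e (Φ z₀)) :=
    hd.hasDerivAt.sub_const _
  have hne : L 1 ≠ 0 := fun h1 => h0 <| hL.symm.trans <|
    ContinuousLinearMap.ext_ring (g := (0 : ℂ →L[ℂ] ℂ)) (by simpa using h1)
  have hec : ContinuousAt (fun z => e (Φ z)) z₀ := (continuousAt_extChartAt _).comp hΦ
  have hinv : HasDerivAt (fun z => e (Φ z)) (L 1)⁻¹ z₀ := by
    refine HasDerivAt.of_local_left_inverse hec hdd hne ?_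
    filter_upwards [hloc, hΦ.eventually (extChartAt_source_mem_nhds (I := 𝓘(ℂ, ℂ)) (Φ z₀))]
      with z hz hzs
    rw [e.left_inv hzs, hz]; ring
  have hm : HasMFDerivAt 𝓘(ℂ, ℂ) 𝓘(ℂ, ℂ) Φ z₀
      (ContinuousLinearMap.toSpanSingleton ℂ (L 1)⁻¹ : ℂ →L[ℂ] ℂ) := by
    refine ⟨hΦ, ?_⟩
    exact hinv.hasFDerivAt.hasFDerivWithinAt
  refine ⟨hm.mdifferentiableAt, ?_⟩
  rw [hm.mfderiv, ← hL]
  change L ((ContinuousLinearMap.toSpanSingleton ℂ (L 1)⁻¹ : ℂ →L[ℂ] ℂ) (1 : ℂ)) = 1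
  rw [ContinuousLinearMap.toSpanSingleton_apply, one_smul, ← mul_one (L 1)⁻¹, ← smul_eq_mul,
    L.map_smul, smul_eq_mul, inv_mul_cancel₀ hne]

/-- Conversely, a holomorphic map from a domain in `ℂ` that pulls `ω` back to `dz` covers a
translation of the torus. -/
lemma IsPullback.exists_lift {ω : OneForm X} {π : X → Torus}
    (hπ : IsPullback ω π) {Φ : ℂ → X} {U : Set ℂ} (hU : IsOpen U) (hU' : IsPreconnected U)
    (hΦ : MDifferentiableOn 𝓘(ℂ, ℂ) 𝓘(ℂ, ℂ) Φ U)
    (h1 : ∀ z ∈ U, ω (Φ z) (mfderiv 𝓘(ℂ, ℂ) 𝓘(ℂ, ℂ) Φ z (1 : ℂ)) = (1 : ℂ)) :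
    ∃ c : ℂ, ∀ z ∈ U, π (Φ z) = toTorus (z + c) := by
  rcases U.eq_empty_or_nonempty with rfl | ⟨z₁, hz₁⟩
  · exact ⟨0, by simp⟩
  have hat : ∀ z ∈ U, MDifferentiableAt 𝓘(ℂ, ℂ) 𝓘(ℂ, ℂ) Φ z := fun z hz =>
    (hΦ z hz).mdifferentiableAt (hU.mem_nhds hz)
  have hloc : IsLocallyConstant (fun z : U => π (Φ z) - toTorus z) := by
    rw [IsLocallyConstant.iff_eventually_eq]
    rintro ⟨z₀, hz₀⟩
    obtain ⟨F, hF⟩ := hπ (Φ z₀)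
    obtain ⟨r, hr, hball⟩ := Metric.eventually_nhds_iff_ball.1
      (((hat z₀ hz₀).continuousAt.eventually hF).and (hU.mem_nhds hz₀))
    have hder : ∀ z ∈ Metric.ball z₀ r,
        HasFDerivAt (fun z => F (Φ z) - z) (0 : ℂ →L[ℂ] ℂ) z := by
      intro z hz
      obtain ⟨⟨-, hFz⟩, hzU⟩ := hball z hz
      have hc := hFz.comp z (hat z hzU).hasMFDerivAt
      have hc' : HasFDerivAt (F ∘ Φ) ((ω (Φ z)).comp (mfderiv 𝓘(ℂ, ℂ) 𝓘(ℂ, ℂ) Φ z) : ℂ →L[ℂ] ℂ) z :=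
        hasMFDerivAt_iff_hasFDerivAt.1 hc
      have hid : ((ω (Φ z)).comp (mfderiv 𝓘(ℂ, ℂ) 𝓘(ℂ, ℂ) Φ z) : ℂ →L[ℂ] ℂ)
          = ContinuousLinearMap.id ℂ ℂ := by
        apply ContinuousLinearMap.ext_ring
        exact h1 z hzU
      rw [hid] at hc'
      rw [← sub_self (ContinuousLinearMap.id ℂ ℂ)]
      exact hc'.sub (hasFDerivAt_id z)
    have hconst : ∀ z ∈ Metric.ball z₀ r, F (Φ z) - z = F (Φ z₀) - z₀ := fun z hz =>
      (convex_ball z₀ r).is_const_of_fderivWithin_eq_zero (𝕜 := ℂ)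
        (fun w hw => (hder w hw).differentiableAt.differentiableWithinAt)
        (fun w hw => (hder w hw).hasFDerivWithinAt.fderivWithin
          (Metric.isOpen_ball.uniqueDiffWithinAt hw))
        hz (Metric.mem_ball_self hr)
    have : ∀ᶠ z : U in 𝓝 ⟨z₀, hz₀⟩, (z : ℂ) ∈ Metric.ball z₀ r :=
      continuous_subtype_val.continuousAt.eventually (Metric.ball_mem_nhds z₀ hr)
    filter_upwards [this] with z hz
    have e1 := hconst z hz
    rw [← (hball z hz).1.1, ← (hball z₀ (Metric.mem_ball_self hr)).1.1]
    exact congrArg toTorus e1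
  have : PreconnectedSpace U := isPreconnected_iff_preconnectedSpace.1 hU'
  obtain ⟨c, hc⟩ := toTorus_surjective (π (Φ z₁) - toTorus z₁)
  refine ⟨c, fun z hz => ?_⟩
  have := hloc.apply_eq_of_isPreconnected (isPreconnected_univ) (x := ⟨z, hz⟩) (y := ⟨z₁, hz₁⟩)
    trivial trivial
  rw [toTorus_add, hc, ← this]
  simp

end Coordinates

/-! ### Sheet changes along a horizontal band -/

/-- The horizontal band of those points of `ℂ` whose height lies in `(0, 1)` and exceeds that of `v`
by a number in `(-κ, 1 - κ)`.  It contains no lattice point and no translate of `v` by one,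
and the horizontal circles in its projection cross the slit `κ` times, counted with sign. -/
def band (v : ℂ) (κ : ℤ) : Set ℂ :=
  {z : ℂ | 0 < z.im ∧ z.im < 1 ∧ -(κ : ℝ) < z.im - v.im ∧ z.im - v.im < 1 - κ}

/-- If the band of `v` and `κ` is nonempty, these are the integers `n` for which the translates
`[λ, λ + v]`, `Im λ = n`, of the segment `[0, v]` meet the band: there are `|κ|` of them. -/
noncomputable def crossings (κ : ℤ) : Finset ℤ := Finset.Ioc (min (-κ) 0) (max (-κ) 0)

/-- The horizontal distance from the line `ℝ v` to `z`, positive on the right hand side of the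
direction `v`.  If `v` is real there is no such distance, and the value is irrelevant since no
translate of `[0, v]` meets the band. -/
noncomputable def rightDist (v z : ℂ) : ℝ := -(z * (starRingEnd ℂ) v).im / |v.im|

/-- The change of sheet along paths in the band, as a function of their end point: up to a constant,
the signed number of translates of `[0, v]` crossed from left to right.  At the height `n` these
translates lie at the integral values of `rightDist v (z - n i)`; the ceiling counts them and, since
it is continuous from the left, puts the points of the slit on its left side. -/
noncomputable def sheetShift (d : ℕ) (v : ℂ) (κ : ℤ) (z : ℂ) : ZMod d :=
  ∑ n ∈ crossings κ, ((⌈rightDist v (z - n * Complex.I)⌉ : ℤ) : ZMod d)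

lemma isOpen_band (v : ℂ) (κ : ℤ) : IsOpen (band v κ) := by
  have h := Complex.continuous_im
  exact (isOpen_lt continuous_const h).inter ((isOpen_lt h continuous_const).inter
    ((isOpen_lt continuous_const (h.sub continuous_const)).inter
      (isOpen_lt (h.sub continuous_const) continuous_const)))

lemma mem_band_congr {v z w : ℂ} {κ : ℤ} (h : z.im = w.im) : z ∈ band v κ ↔ w ∈ band v κ := by
  simp only [band, Set.mem_ofPred_eq, h]

lemma toTorus_ne_zero_of_mem_band {v z : ℂ} {κ : ℤ} (hz : z ∈ band v κ) : toTorus z ≠ 0 := by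
  intro h
  obtain ⟨m, n, rfl⟩ := toTorus_eq_zero_iff.1 h
  obtain ⟨h0, h1, -, -⟩ := hz
  simp at h0 h1
  norm_cast at h0 h1
  omega

lemma toTorus_ne_of_mem_band {v z : ℂ} {κ : ℤ} (hz : z ∈ band v κ) :
    toTorus z ≠ toTorus v := by
  intro h
  obtain ⟨m, n, rfl⟩ := toTorus_eq_iff.1 h.symm
  obtain ⟨-, -, h0, h1⟩ := hz
  simp at h0 h1
  norm_cast at h0 h1
  omega

lemma rightDist_add (v z w : ℂ) : rightDist v (z + w) = rightDist v z + rightDist v w := by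
  simp only [rightDist, add_mul, Complex.add_im]; ring

/-- Near a point the ceiling function is constant on the left, and it jumps by one on the right
exactly if the point is an integer. -/
lemma eventually_ceil_add (x : ℝ) :
    ∀ᶠ t in 𝓝 (0 : ℝ), ⌈x + t⌉ = ⌈x⌉ + if 0 < t ∧ (⌈x⌉ : ℝ) = x then 1 else 0 := by
  have hx := Int.ceil_lt_add_one x
  have hx' := Int.le_ceil x
  rcases hx'.eq_or_lt with h | h
  · have : ∀ᶠ t in 𝓝 (0 : ℝ), t ∈ Set.Ioo (-1 : ℝ) 1 := Ioo_mem_nhds (by norm_num) (by norm_num)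
    filter_upwards [this] with t ht
    split_ifs with hc
    · rw [Int.ceil_eq_iff]; push_cast; constructor <;> linarith [ht.1, ht.2, hc.1]
    · have : t ≤ 0 := not_lt.1 fun h' => hc ⟨h', h.symm⟩
      rw [Int.ceil_eq_iff]; push_cast; constructor <;> linarith [ht.1, ht.2]
  · have : ∀ᶠ t in 𝓝 (0 : ℝ), t ∈ Set.Ioo (⌈x⌉ - 1 - x) (⌈x⌉ - x) :=
      Ioo_mem_nhds (by linarith) (by linarith)
    filter_upwards [this] with t ht
    rw [if_neg (fun hc => h.ne hc.2.symm), Int.ceil_eq_iff]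
    push_cast; constructor <;> linarith [ht.1, ht.2]

/-- If `n` indexes a crossing, then `v` is not real, and the segment `[0, v]` shifted up by `n`
reaches the height of each point of the band. -/
lemma im_ne_zero_and_mem_Icc_of_mem_crossings {v z : ℂ} {κ n : ℤ} (hz : z ∈ band v κ)
    (hn : n ∈ crossings κ) : v.im ≠ 0 ∧ (z.im - n) / v.im ∈ Set.Icc (0 : ℝ) 1 := by
  obtain ⟨h0, h1, h2, h3⟩ := hz
  rw [crossings, Finset.mem_Ioc, min_lt_iff, le_max_iff] at hn
  rcases le_or_gt n 0 with hn0 | hn0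
  · have hn' : -κ + 1 ≤ n := by omega
    have a : (n : ℝ) ≤ 0 := by exact_mod_cast hn0
    have b : -(κ : ℝ) + 1 ≤ n := by exact_mod_cast hn'
    have c : 0 < v.im := by linarith
    exact ⟨c.ne', div_nonneg (by linarith) c.le, (div_le_one c).2 (by linarith)⟩
  · have hn' : n ≤ -κ := by omega
    have a : (1 : ℝ) ≤ n := by exact_mod_cast hn0
    have b : (n : ℝ) ≤ -κ := by exact_mod_cast hn'
    have c : v.im < 0 := by linarith
    exact ⟨c.ne, div_nonneg_of_nonpos (by linarith) c.le, (div_le_one_of_neg c).2 (by linarith)⟩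

lemma mem_crossings_of_im_eq {v z : ℂ} {κ n : ℤ} (hz : z ∈ band v κ) {s : ℝ}
    (hs : s ∈ Set.Icc (0 : ℝ) 1) (h : z.im = s * v.im + n) : n ∈ crossings κ := by
  obtain ⟨h0, h1, h2, h3⟩ := hz
  obtain ⟨s0, s1⟩ := hs
  rw [crossings, Finset.mem_Ioc, min_lt_iff, le_max_iff]
  rcases le_total 0 v.im with hv | hv
  · have a : 0 ≤ s * v.im := mul_nonneg s0 hv
    have b : s * v.im ≤ v.im := mul_le_of_le_one_left hv s1
    have c : n < 1 := by exact_mod_cast (by linarith : (n : ℝ) < 1)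
    have e : -κ < n := by exact_mod_cast (by linarith : -(κ : ℝ) < n)
    omega
  · have a : s * v.im ≤ 0 := mul_nonpos_of_nonneg_of_nonpos s0 hv
    have b : v.im ≤ s * v.im := le_mul_of_le_one_left hv s1
    have c : 0 < n := by exact_mod_cast (by linarith : (0 : ℝ) < n)
    have e : n < 1 - κ := by exact_mod_cast (by linarith : (n : ℝ) < 1 - κ)
    omega

/-- The segment passes through `[z]` once for each `n` such that a translate of `[0, v]` by a lattice
point of height `n` contains `z`, that is, such that `z - n i` has integral horizontal distance to
the line `ℝ v`. -/
lemma passes_toTorus {v z : ℂ} {κ : ℤ} (hz : z ∈ band v κ) :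
    passes v (toTorus z) = ((crossings κ).filter fun n : ℤ =>
      ((⌈rightDist v (z - n * Complex.I)⌉ : ℤ) : ℝ) = rightDist v (z - n * Complex.I)).card := by
  have key : ∀ (n : ℤ), v.im ≠ 0 → (rightDist v (z - n * Complex.I)) =
      (z.re - (z.im - n) / v.im * v.re) * (v.im / |v.im|) := by
    intro n hv
    have : |v.im| ≠ 0 := abs_ne_zero.2 hv
    simp only [rightDist, Complex.mul_im, Complex.sub_re, Complex.sub_im, Complex.mul_re,
      Complex.conj_re, Complex.conj_im, Complex.intCast_re, Complex.intCast_im, Complex.I_re,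
      Complex.I_im]
    field_simp
    ring
  have sgn : ∀ x : ℝ, v.im ≠ 0 → ((∃ m : ℤ, x = m) ↔
      ((⌈x * (v.im / |v.im|)⌉ : ℤ) : ℝ) = x * (v.im / |v.im|)) := by
    intro x hv
    rcases hv.lt_or_gt with h | h
    · rw [abs_of_neg h, div_neg, div_self hv]
      constructor
      · rintro ⟨m, rfl⟩
        rw [mul_neg_one, ← Int.cast_neg, Int.ceil_intCast]
      · intro e
        exact ⟨-⌈x * -1⌉, by push_cast; linarith⟩
    · rw [abs_of_pos h, div_self hv]
      constructor
      · rintro ⟨m, rfl⟩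
        rw [mul_one, Int.ceil_intCast]
      · intro e
        exact ⟨⌈x * 1⌉, by linarith⟩
  have cover : ∀ n : ℤ, v.im ≠ 0 →
      (((⌈rightDist v (z - n * Complex.I)⌉ : ℤ) : ℝ) = rightDist v (z - n * Complex.I) ↔
        ∃ m : ℤ, z = ((z.im - n) / v.im : ℝ) * v + m + n * Complex.I) := by
    intro n hv
    rw [key n hv, ← sgn _ hv]
    refine exists_congr fun m => ?_
    rw [Complex.ext_iff]
    simp only [Complex.add_re, Complex.add_im, Complex.ofReal_re, Complex.ofReal_im,
      Complex.intCast_re, Complex.intCast_im, Complex.mul_re, Complex.mul_im, Complex.I_re,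
      Complex.I_im]
    have := div_mul_cancel₀ (z.im - n) hv
    constructor
    · intro h
      constructor <;> linarith
    · rintro ⟨h, -⟩
      linarith
  rw [passes, ← Nat.card_eq_finsetCard]
  symm
  refine Nat.card_eq_of_bijective (fun n => ⟨(z.im - (n : ℤ)) / v.im, ?_, ?_⟩) ⟨?_, ?_⟩
  · exact (im_ne_zero_and_mem_Icc_of_mem_crossings hz (Finset.mem_filter.1 n.2).1).2
  · obtain ⟨h1, h2⟩ := Finset.mem_filter.1 n.2
    obtain ⟨m, hm⟩ := (cover n (im_ne_zero_and_mem_Icc_of_mem_crossings hz h1).1).1 h2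
    exact toTorus_eq_iff.2 ⟨m, n, hm⟩
  · intro n n' h
    have hv := (im_ne_zero_and_mem_Icc_of_mem_crossings hz (Finset.mem_filter.1 n.2).1).1
    have h' := congrArg Subtype.val h
    dsimp only at h'
    rw [div_left_inj' hv, sub_right_inj] at h'
    exact Subtype.ext (by exact_mod_cast h')
  · rintro ⟨s, hs, hsz⟩
    obtain ⟨m, n, hmn⟩ := toTorus_eq_iff.1 hsz
    have him : z.im = s * v.im + n := by
      have := congrArg Complex.im hmn
      simpa using this
    have hn := mem_crossings_of_im_eq hz hs him
    have hv := (im_ne_zero_and_mem_Icc_of_mem_crossings hz hn).1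
    have hsv : (z.im - n) / v.im = s := by rw [him]; field_simp; ring
    refine ⟨⟨n, Finset.mem_filter.2 ⟨hn, (cover n hv).2 ⟨m, ?_⟩⟩⟩, Subtype.ext hsv⟩
    rw [hsv]; exact hmn

/-- Under a small displacement `sheetShift` changes as the sheets of `SlitSum` do. -/
lemma eventually_sheetShift_add (d : ℕ) {v z : ℂ} {κ : ℤ} (hz : z ∈ band v κ) :
    ∀ᶠ u in 𝓝 (0 : ℂ),
      sheetShift d v κ (z + u) = sheetShift d v κ z + jump d v (toTorus z) u := by
  have hr : Filter.Tendsto (rightDist v) (𝓝 0) (𝓝 0) := by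
    have : Continuous (rightDist v) := by unfold rightDist; fun_prop
    simpa [rightDist] using this.tendsto 0
  have hall : ∀ᶠ u in 𝓝 (0 : ℂ), ∀ n ∈ crossings κ, _ := (Finset.eventually_all _).2 fun n _ =>
    hr.eventually (eventually_ceil_add (rightDist v (z - n * Complex.I)))
  filter_upwards [hall] with u hu
  have hsum : sheetShift d v κ (z + u) = sheetShift d v κ z + ∑ n ∈ crossings κ,
      if 0 < rightDist v u ∧ ((⌈rightDist v (z - n * Complex.I)⌉ : ℤ) : ℝ) =
        rightDist v (z - n * Complex.I) then 1 else 0 := by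
    rw [sheetShift, sheetShift, ← Finset.sum_add_distrib]
    refine Finset.sum_congr rfl fun n hn => ?_
    rw [add_sub_right_comm, rightDist_add, hu n hn]
    split_ifs <;> simp
  rw [hsum, jump, passes_toTorus hz]
  congr 1
  rcases (crossings κ).eq_empty_or_nonempty with he | ⟨n₀, hn₀⟩
  · simp [he]
  have hv := (im_ne_zero_and_mem_Icc_of_mem_crossings hz hn₀).1
  have hpos : 0 < rightDist v u ↔ (u * (starRingEnd ℂ) v).im < 0 := by
    rw [rightDist, div_pos_iff_of_pos_right (abs_pos.2 hv), neg_pos]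
  simp only [hpos]
  split_ifs with h
  · simp only [h, true_and, Finset.sum_boole]
  · simp only [h, false_and, if_false, Finset.sum_const_zero]

/-- The monodromy of a horizontal circle in the projected band is `κ`. -/
lemma sheetShift_add_intCast (d : ℕ) {v z : ℂ} {κ : ℤ} (hz : z ∈ band v κ) (m : ℤ) :
    sheetShift d v κ (z + m) = sheetShift d v κ z + m * κ := by
  obtain ⟨h0, h1, h2, h3⟩ := hz
  have hm : rightDist v m = m * (v.im / |v.im|) := by
    simp [rightDist]; ring
  have key : ∀ e : ℤ, v.im / |v.im| = e →
      sheetShift d v κ (z + m) = sheetShift d v κ z + (crossings κ).card * (m * e : ℤ) := by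
    intro e he
    rw [sheetShift, sheetShift, ← nsmul_eq_mul, ← Finset.sum_const, ← Finset.sum_add_distrib]
    refine Finset.sum_congr rfl fun n hn => ?_
    rw [add_sub_right_comm, rightDist_add, hm, he, ← Int.cast_mul, Int.ceil_add_intCast,
      Int.cast_add]
  have hcard : ((crossings κ).card : ℤ) = |κ| := by
    rw [crossings, Int.card_Ioc, max_sub_min_eq_abs', sub_zero, abs_neg]
    exact Int.toNat_of_nonneg (abs_nonneg κ)
  have hcard' : ((crossings κ).card : ZMod d) = ((|κ| : ℤ) : ZMod d) := by
    rw [← hcard]; simp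
  rcases lt_trichotomy κ 0 with hκ | rfl | hκ
  · have a : (κ : ℝ) ≤ -1 := by exact_mod_cast (by omega : κ ≤ -1)
    have c : v.im < 0 := by linarith
    rw [key (-1) (by rw [abs_of_neg c, div_neg, div_self c.ne]; simp), hcard', abs_of_neg hκ]
    push_cast; ring
  · simp [sheetShift, crossings]
  · have a : (1 : ℝ) ≤ κ := by exact_mod_cast (by omega : 1 ≤ κ)
    have c : 0 < v.im := by linarith
    rw [key 1 (by rw [abs_of_pos c, div_self c.ne']; simp), hcard', abs_of_pos hκ]
    push_cast; ring

/-! ### Lifting the band to the slit sum -/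

section BandLift

variable {d : ℕ} {v : ℂ} {κ : ℤ}

/-- The lift of the band to `SlitSum d v` that starts from the sheet `k`. -/
noncomputable def bandLift (d : ℕ) (v : ℂ) (κ : ℤ) (k : ZMod d) (z : band v κ) : SlitSum d v where
  base := toTorus z
  base_ne_zero := toTorus_ne_zero_of_mem_band z.2
  base_ne := toTorus_ne_of_mem_band z.2
  sheet := k + sheetShift d v κ z

lemma continuous_bandLift (k : ZMod d) : Continuous (bandLift d v κ k) := by
  refine continuous_def.2 fun U hU => isOpen_iff_mem_nhds.2 fun z hz => ?_
  obtain ⟨ε, hε, h⟩ := hU _ hz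
  have hsub : Filter.Tendsto (fun z' : band v κ => (z' : ℂ) - z) (𝓝 z) (𝓝 0) := by
    have : Continuous (fun z' : band v κ => (z' : ℂ) - z) := by fun_prop
    simpa using this.tendsto z
  filter_upwards [hsub.eventually (eventually_sheetShift_add d z.2),
    hsub.eventually (Metric.ball_mem_nhds 0 hε)] with z' h1 h2
  rw [add_sub_cancel] at h1
  refine h (z' - z) _ (by simpa using h2) ?_ ?_
  · change toTorus z' = toTorus z + toTorus (z' - z)
    rw [← toTorus_add, add_sub_cancel]
  · change k + sheetShift d v κ z' = k + sheetShift d v κ z + _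
    rw [h1, add_assoc]
    rfl

lemma isOpen_range_bandLift (k : ZMod d) : IsOpen (Set.range (bandLift d v κ k)) := by
  rintro _ ⟨z, rfl⟩
  have hadd : Filter.Tendsto (fun u : ℂ => (z : ℂ) + u) (𝓝 0) (𝓝 z) := by
    have : Continuous (fun u : ℂ => (z : ℂ) + u) := by fun_prop
    simpa using this.tendsto 0
  obtain ⟨ε, hε, h⟩ := Metric.eventually_nhds_iff.1 ((eventually_sheetShift_add d z.2).and
    (hadd.eventually ((isOpen_band v κ).mem_nhds z.2)))
  refine ⟨ε, hε, fun u y hu hb hs => ?_⟩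
  obtain ⟨h1, h2⟩ := h (by simpa using hu : dist u 0 < ε)
  refine ⟨⟨z + u, h2⟩, SlitSum.ext ?_ ?_⟩
  · rw [hb]; rfl
  · rw [hs]
    change k + sheetShift d v κ (z + u) = k + sheetShift d v κ z + _
    rw [h1, add_assoc]
    rfl

lemma bandLift_eq_iff {k k' : ZMod d} {z z' : band v κ} :
    bandLift d v κ k z = bandLift d v κ k' z' ↔
      ∃ n : ℤ, (z' : ℂ) = z + n ∧ k = k' + n * κ := by
  rw [SlitSum.ext_iff]
  change toTorus z = toTorus z' ∧ k + sheetShift d v κ z = k' + sheetShift d v κ z' ↔ _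
  constructor
  · rintro ⟨h1, h2⟩
    obtain ⟨m, n, h⟩ := toTorus_eq_iff.1 h1
    have him : (z' : ℂ).im = (z : ℂ).im + n := by simpa using congrArg Complex.im h
    have hn : n = 0 := by
      obtain ⟨a, b, -, -⟩ := z.2
      obtain ⟨a', b', -, -⟩ := z'.2
      have e : n < 1 := by exact_mod_cast (by linarith : (n : ℝ) < 1)
      have f : -1 < n := by exact_mod_cast (by linarith : (-1 : ℝ) < n)
      omega
    rw [hn, Int.cast_zero, zero_mul, add_zero] at h
    refine ⟨m, h, ?_⟩
    rw [h, sheetShift_add_intCast d z.2] at h2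
    linear_combination h2
  · rintro ⟨n, h, rfl⟩
    refine ⟨toTorus_eq_iff.2 ⟨n, 0, by simpa using h⟩, ?_⟩
    rw [h, sheetShift_add_intCast d z.2]
    ring

lemma exists_bandLift_eq {x : SlitSum d v} {z : ℂ} (hz : z ∈ band v κ) (h : x.base = toTorus z) :
    ∃ k : ZMod d, bandLift d v κ k ⟨z, hz⟩ = x :=
  ⟨x.sheet - sheetShift d v κ z, SlitSum.ext h.symm (sub_add_cancel _ _)⟩

end BandLift

/-! ### The cylinders over a band -/

section Cylinders

variable {X : Type*} [TopologicalSpace X] {d : ℕ} {v : ℂ} {p₀ p₁ : X}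

open Classical in
/-- The lift of the band to `X`, along an identification `f` of `X ∖ {p₀, p₁}` with
`SlitSum d v`; it takes the meaningless value `p₀` outside the band. -/
noncomputable def bandMap (f : {x : X // x ≠ p₀ ∧ x ≠ p₁} ≃ₜ SlitSum d v) (κ : ℤ) (k : ZMod d)
    (z : ℂ) : X :=
  if h : z ∈ band v κ then (f.symm (bandLift d v κ k ⟨z, h⟩)).1 else p₀

/-- The image of the lift of the band that starts from the sheet `k`. -/
def bandCylinder (f : {x : X // x ≠ p₀ ∧ x ≠ p₁} ≃ₜ SlitSum d v) (κ : ℤ) (k : ZMod d) : Set X :=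
  bandMap f κ k '' band v κ

variable (f : {x : X // x ≠ p₀ ∧ x ≠ p₁} ≃ₜ SlitSum d v) {κ : ℤ}

lemma bandMap_of_mem (k : ZMod d) {z : ℂ} (h : z ∈ band v κ) :
    bandMap f κ k z = (f.symm (bandLift d v κ k ⟨z, h⟩)).1 := dif_pos h

lemma bandMap_notMem (k : ZMod d) {z : ℂ} (h : z ∈ band v κ) :
    bandMap f κ k z ∉ ({p₀, p₁} : Set X) := by
  rw [bandMap_of_mem f k h]
  have := (f.symm (bandLift d v κ k ⟨z, h⟩)).2
  simpa [not_or] using this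

lemma bandMap_eq_iff {k k' : ZMod d} {z z' : ℂ} (hz : z ∈ band v κ) (hz' : z' ∈ band v κ) :
    bandMap f κ k z = bandMap f κ k' z' ↔ ∃ n : ℤ, z' = z + n ∧ k = k' + n * κ := by
  rw [bandMap_of_mem f k hz, bandMap_of_mem f k' hz', Subtype.val_inj, f.symm.injective.eq_iff,
    bandLift_eq_iff]

lemma continuousOn_bandMap (k : ZMod d) : ContinuousOn (bandMap f κ k) (band v κ) := by
  rw [continuousOn_iff_continuous_domRestrict]
  have : (band v κ).domRestrict (bandMap f κ k) = fun z => (f.symm (bandLift d v κ k z)).1 :=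
    funext fun z => bandMap_of_mem f k z.2
  rw [this]
  exact continuous_subtype_val.comp (f.symm.continuous.comp (continuous_bandLift k))

lemma isOpen_bandCylinder [T1Space X] (k : ZMod d) : IsOpen (bandCylinder f κ k) := by
  have hopen : IsOpen {x : X | x ≠ p₀ ∧ x ≠ p₁} := isOpen_ne.inter isOpen_ne
  have : bandCylinder f κ k = Subtype.val '' (f.symm '' Set.range (bandLift d v κ k)) := by
    ext x
    constructor
    · rintro ⟨z, hz, rfl⟩
      exact ⟨_, ⟨_, ⟨⟨z, hz⟩, rfl⟩, rfl⟩, (bandMap_of_mem f k hz).symm⟩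
    · rintro ⟨_, ⟨_, ⟨z, rfl⟩, rfl⟩, rfl⟩
      exact ⟨z, z.2, bandMap_of_mem f k z.2⟩
  rw [this]
  exact hopen.isOpenMap_subtype_val _ (f.symm.isOpenMap _ (isOpen_range_bandLift k))

lemma bandCylinder_congr {k k' : ZMod d} (h : k - k' ∈ AddSubgroup.zmultiples (κ : ZMod d)) :
    bandCylinder f κ k = bandCylinder f κ k' := by
  suffices ∀ k k' : ZMod d, k - k' ∈ AddSubgroup.zmultiples (κ : ZMod d) →
      bandCylinder f κ k ⊆ bandCylinder f κ k' by
    refine (this k k' h).antisymm (this k' k ?_)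
    rw [← neg_sub]
    exact neg_mem h
  rintro k k' ⟨n, hn⟩ _ ⟨z, hz, rfl⟩
  have hz' : z + n ∈ band v κ := (mem_band_congr (by simp)).1 hz
  refine ⟨z + n, hz', ((bandMap_eq_iff f hz hz').2 ⟨n, rfl, ?_⟩).symm⟩
  simp only [zsmul_eq_mul] at hn
  rw [hn, add_sub_cancel]

variable {f} {π : X → Torus}

lemma apply_bandMap (hf : ∀ x, (f x).base = π x) (k : ZMod d) {z : ℂ} (h : z ∈ band v κ) :
    π (bandMap f κ k z) = toTorus z := by
  rw [bandMap_of_mem f k h, ← hf, f.apply_symm_apply]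
  rfl

/-- Two cylinders over bands that have a point in common coincide: they lie over the same band,
and their sheets differ by a multiple of the monodromy. -/
lemma eq_and_sub_mem_of_mem_bandCylinder (hf : ∀ x, (f x).base = π x) {κ' : ℤ} {k k' : ZMod d}
    {x : X} (h : x ∈ bandCylinder f κ k) (h' : x ∈ bandCylinder f κ' k') :
    κ = κ' ∧ k - k' ∈ AddSubgroup.zmultiples (κ : ZMod d) := by
  obtain ⟨z, hz, rfl⟩ := h
  obtain ⟨z', hz', hzz'⟩ := h'
  have hκ : κ = κ' := by
    have := congrArg π hzz'
    rw [apply_bandMap hf k hz, apply_bandMap hf k' hz', toTorus_eq_iff] at this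
    obtain ⟨m, n, h⟩ := this
    have him : z.im = z'.im + n := by simpa using congrArg Complex.im h
    obtain ⟨a, b, a1, b1⟩ := hz
    obtain ⟨a', b', a2, b2⟩ := hz'
    have e : n < 1 := by exact_mod_cast (by linarith : (n : ℝ) < 1)
    have f : -1 < n := by exact_mod_cast (by linarith : (-1 : ℝ) < n)
    obtain rfl : n = 0 := by omega
    rw [Int.cast_zero, add_zero] at him
    have e : κ - κ' < 1 := by exact_mod_cast (by linarith : (κ : ℝ) - κ' < 1)
    have f : -1 < κ - κ' := by exact_mod_cast (by linarith : (-1 : ℝ) < κ - κ')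
    omega
  subst hκ
  obtain ⟨n, -, rfl⟩ := (bandMap_eq_iff f hz hz').1 hzz'.symm
  exact ⟨rfl, n, by simp⟩

lemma eq_of_bandCylinder_subset (hf : ∀ x, (f x).base = π x) (hκ : (band v κ).Nonempty)
    {κ' : ℤ} {k k' : ZMod d} (h : bandCylinder f κ k ⊆ bandCylinder f κ' k') :
    bandCylinder f κ k = bandCylinder f κ' k' := by
  obtain ⟨z, hz⟩ := hκ
  have hx : bandMap f κ k z ∈ bandCylinder f κ k := ⟨z, hz, rfl⟩
  obtain ⟨rfl, hk⟩ := eq_and_sub_mem_of_mem_bandCylinder hf hx (h hx)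
  exact bandCylinder_congr f hk

/-- The cylinders over a band correspond to the cosets of the subgroup that the monodromy
generates in `ℤ/dℤ`. -/
lemma encard_range_bandCylinder (hd : 1 ≤ d) (hf : ∀ x, (f x).base = π x)
    (hκ : (band v κ).Nonempty) :
    (Set.range (bandCylinder f κ)).encard = (AddSubgroup.zmultiples (κ : ZMod d)).index := by
  have : NeZero d := ⟨by omega⟩
  have hrel : ∀ k k' : ZMod d, bandCylinder f κ k = bandCylinder f κ k' ↔
      (k : ZMod d ⧸ AddSubgroup.zmultiples (κ : ZMod d)) = k' := by
    intro k k'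
    rw [eq_comm (a := (k : ZMod d ⧸ AddSubgroup.zmultiples (κ : ZMod d))), QuotientAddGroup.eq,
      neg_add_eq_sub]
    refine ⟨fun h => ?_, bandCylinder_congr f⟩
    obtain ⟨z, hz⟩ := hκ
    have hx : bandMap f κ k z ∈ bandCylinder f κ k := ⟨z, hz, rfl⟩
    exact (eq_and_sub_mem_of_mem_bandCylinder hf hx (h ▸ hx)).2
  let F : ZMod d ⧸ AddSubgroup.zmultiples (κ : ZMod d) → Set X :=
    fun q => bandCylinder f κ q.out
  have hF : ∀ k : ZMod d, F k = bandCylinder f κ k := fun k =>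
    (hrel _ _).2 (Quotient.out_eq _)
  have hrange : Set.range (bandCylinder f κ) = Set.range F := by
    ext C
    constructor
    · rintro ⟨k, rfl⟩; exact ⟨k, hF k⟩
    · rintro ⟨q, rfl⟩; exact ⟨_, rfl⟩
  have hinj : Function.Injective F := by
    intro q q' h
    have := (hrel _ _).1 h
    rwa [QuotientAddGroup.out_eq', QuotientAddGroup.out_eq'] at this
  rw [hrange, ← Set.image_univ, hinj.encard_image, Set.encard_univ, AddSubgroup.index,
    ENat.card_eq_coe_natCard]

end Cylinders

lemma addOrderOf_intCast {d : ℕ} (hd : 1 ≤ d) (κ : ℤ) :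
    addOrderOf (κ : ZMod d) = d / Int.gcd κ d := by
  have h : addOrderOf (κ : ZMod d) = addOrderOf ((κ.natAbs : ℕ) : ZMod d) := by
    rcases Int.natAbs_eq κ with h | h
    · conv_lhs => rw [h]
      rw [Int.cast_natCast]
    · conv_lhs => rw [h]
      rw [Int.cast_neg, Int.cast_natCast, addOrderOf_neg]
  rw [h, ZMod.addOrderOf_coe _ (by omega), Nat.gcd_comm]
  rfl

lemma index_zmultiples_intCast {d : ℕ} (hd : 1 ≤ d) (κ : ℤ) :
    (AddSubgroup.zmultiples (κ : ZMod d)).index = Int.gcd κ d := by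
  have : NeZero d := ⟨by omega⟩
  have h := AddSubgroup.card_mul_index (AddSubgroup.zmultiples (κ : ZMod d))
  rw [Nat.card_zmultiples, addOrderOf_intCast hd, Nat.card_zmod] at h
  have hdvd : Int.gcd κ d ∣ d := by exact_mod_cast Int.gcd_dvd_right κ d
  obtain ⟨e, he⟩ := hdvd
  have hg : 0 < Int.gcd κ d := Nat.pos_of_ne_zero fun h0 => by rw [h0] at he; omega
  rw [Nat.div_eq_of_eq_mul_right hg he] at h
  have he0 : 0 < e := Nat.pos_of_ne_zero fun h0 => by rw [h0] at he; omega
  exact Nat.eq_of_mul_eq_mul_left he0 (by rw [h, mul_comm e]; exact he)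

/-! ### Classification of the horizontal cylinders -/

lemma isOpen_strip (h : ℝ) : IsOpen (strip h) :=
  (isOpen_lt continuous_const Complex.continuous_im).inter
    (isOpen_lt Complex.continuous_im continuous_const)

lemma convex_strip (h : ℝ) : Convex ℝ (strip h) :=
  (convex_halfSpace_im_gt 0).inter (convex_halfSpace_im_lt h)

/-- An interval whose translate contains no integer lies between two consecutive ones. -/
lemma floor_add_eq_of_forall_ne {h a : ℝ} (ha : ∀ t, 0 < t → t < h → ∀ n : ℤ, t + a ≠ n)
    {s t : ℝ} (hs : 0 < s) (hs' : s < h) (ht : 0 < t) (ht' : t < h) : ⌊s + a⌋ = ⌊t + a⌋ := by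
  suffices ∀ s t : ℝ, 0 < s → s < h → 0 < t → t < h → ⌊s + a⌋ ≤ ⌊t + a⌋ from
    (this s t hs hs' ht ht').antisymm (this t s ht ht' hs hs')
  intro s t hs hs' ht ht'
  by_contra! hlt
  have h1 := Int.floor_lt.1 hlt
  have h2 := Int.floor_le (s + a)
  exact ha (⌊s + a⌋ - a) (by linarith) (by linarith) _ (sub_add_cancel _ _)

section Classification

variable {X : Type*} [TopologicalSpace X] [ChartedSpace ℂ X] {d : ℕ} {v : ℂ} {p₀ p₁ : X}
  {f : {x : X // x ≠ p₀ ∧ x ≠ p₁} ≃ₜ SlitSum d v} {π : X → Torus} {ω : OneForm X} {κ : ℤ}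

lemma isCylinder_bandCylinder (hd : 1 ≤ d) (hf : ∀ x, (f x).base = π x) (hπ : IsPullback ω π)
    (hω : ∀ x, x ≠ p₀ → x ≠ p₁ → ω x ≠ 0) (hκ : (band v κ).Nonempty) (k : ZMod d) :
    IsCylinder ω {p₀, p₁} (addOrderOf (κ : ZMod d)) (bandCylinder f κ k) := by
  have : NeZero d := ⟨by omega⟩
  refine ⟨by exact_mod_cast addOrderOf_pos (κ : ZMod d), ?_⟩
  obtain ⟨z₁, hz₁⟩ := hκ
  -- the heights of the band form the interval `(a, b)`
  set a : ℝ := max 0 (v.im - κ)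
  set b : ℝ := min 1 (v.im - κ + 1)
  have hmem : ∀ z : ℂ, z + a * Complex.I ∈ band v κ ↔ z ∈ strip (b - a) := by
    intro z
    have him : (z + a * Complex.I).im = z.im + a := by simp
    have h1 : z.im + a < b ↔ z.im + a < 1 ∧ z.im + a < v.im - κ + 1 := lt_min_iff
    have h2 : a < z.im + a ↔ 0 < z.im + a ∧ v.im - κ < z.im + a := max_lt_iff
    rw [lt_add_iff_pos_left] at h2
    simp only [band, strip, Set.mem_ofPred_eq, him, h2, lt_sub_iff_add_lt, h1]
    constructor
    · rintro ⟨h1, h2, h3, h4⟩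
      refine ⟨⟨h1, ?_⟩, h2, ?_⟩ <;> linarith
    · rintro ⟨⟨h1, h2⟩, h3, h4⟩
      refine ⟨h1, h3, ?_, ?_⟩ <;> linarith
  have hab : 0 < b - a := by
    have := (hmem (z₁ - a * Complex.I)).1 (by rwa [sub_add_cancel])
    exact this.1.trans this.2
  have hcov : ∀ z ∈ strip (b - a),
      MDifferentiableAt 𝓘(ℂ, ℂ) 𝓘(ℂ, ℂ) (fun z => bandMap f κ k (z + a * Complex.I)) z ∧
      ω (bandMap f κ k (z + a * Complex.I)) (mfderiv 𝓘(ℂ, ℂ) 𝓘(ℂ, ℂ)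
        (fun z => bandMap f κ k (z + a * Complex.I)) z (1 : ℂ)) = (1 : ℂ) := by
    intro z hz
    have hnot := bandMap_notMem f k ((hmem z).2 hz)
    rw [Set.mem_insert_iff, Set.mem_singleton_iff, not_or] at hnot
    refine hπ.mdifferentiableAt_of_lift (Φ := fun z => bandMap f κ k (z + a * Complex.I))
      (c := a * Complex.I) ?_ ?_ (hω _ hnot.1 hnot.2)
    · have h1 : ContinuousAt (bandMap f κ k) (z + a * Complex.I) :=
        (continuousOn_bandMap f k).continuousAt ((isOpen_band v κ).mem_nhds ((hmem z).2 hz))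
      exact ContinuousAt.comp (f := fun z : ℂ => z + a * Complex.I) h1 (by fun_prop)
    · filter_upwards [(isOpen_strip _).mem_nhds hz] with w hw
      exact apply_bandMap hf k ((hmem w).2 hw)
  refine ⟨b - a, fun z => bandMap f κ k (z + a * Complex.I), hab,
    fun z hz => (hcov z hz).1.mdifferentiableWithinAt,
    fun z hz => bandMap_notMem f k ((hmem z).2 hz), fun z hz => (hcov z hz).2, ?_, ?_⟩
  · intro z hz z' hz'
    rw [bandMap_eq_iff f ((hmem z).2 hz) ((hmem z').2 hz')]
    constructor
    · rintro ⟨n, h, hn⟩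
      have hn0 : n • (κ : ZMod d) = 0 := by rw [zsmul_eq_mul]; exact left_eq_add.1 hn
      obtain ⟨m, rfl⟩ := addOrderOf_dvd_iff_zsmul_eq_zero.2 hn0
      refine ⟨m, ?_⟩
      push_cast at h ⊢
      linear_combination h
    · rintro ⟨n, h⟩
      refine ⟨addOrderOf (κ : ZMod d) * n, ?_, ?_⟩
      · rw [h]; push_cast; ring
      · have := addOrderOf_dvd_iff_zsmul_eq_zero.1
          (Dvd.intro n rfl : (addOrderOf (κ : ZMod d) : ℤ) ∣ addOrderOf (κ : ZMod d) * n)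
        rw [zsmul_eq_mul] at this
        rw [this, add_zero]
  · ext x
    constructor
    · rintro ⟨z, hz, rfl⟩
      exact ⟨z - a * Complex.I, (hmem _).1 (by rwa [sub_add_cancel]), by simp⟩
    · rintro ⟨z, hz, rfl⟩
      exact ⟨_, (hmem z).2 hz, rfl⟩

/-- A horizontal cylinder contains with each point the closed leaf through it, which covers the
whole horizontal circle at that height in the torus.  So it avoids the heights of `[0]` and `[v]`,
over which the only points are `p₀` and `p₁`; hence it lies over a single band. -/
lemma IsCylinder.subset_bandCylinder [T1Space X] (hf : ∀ x, (f x).base = π x)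
    (hπ : IsPullback ω π) {w : ℝ} {C : Set X} (hC : IsCylinder ω {p₀, p₁} w C) :
    ∃ (κ : ℤ) (k : ZMod d), (band v κ).Nonempty ∧ C ⊆ bandCylinder f κ k := by
  obtain ⟨-, h, Φ, hh, hΦ, hS, hdz, -, rfl⟩ := hC
  have hconn := (convex_strip h).isPreconnected
  obtain ⟨c, hc⟩ := hπ.exists_lift (isOpen_strip h) hconn hΦ hdz
  have hS' : ∀ z ∈ strip h, Φ z ≠ p₀ ∧ Φ z ≠ p₁ := fun z hz => by
    simpa [not_or] using hS z hz
  have hbase : ∀ z (hz : z ∈ strip h), (f ⟨Φ z, hS' z hz⟩).base = toTorus (z + c) :=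
    fun z hz => (hf _).trans (hc z hz)
  have hleaf : ∀ t : ℝ, 0 < t → t < h → ∀ (q : ℂ) (n : ℤ), t + (c.im - q.im) = n →
      ∃ z, ∃ hz : z ∈ strip h, (f ⟨Φ z, hS' z hz⟩).base = toTorus q := by
    intro t ht ht' q n hn
    have hz : (⟨q.re - c.re, t⟩ : ℂ) ∈ strip h := ⟨ht, ht'⟩
    refine ⟨_, hz, (hbase _ hz).trans (toTorus_eq_iff.2 ⟨0, -n, ?_⟩)⟩
    apply Complex.ext
    · simp
    · simp; linarith
  have hne0 : ∀ t, 0 < t → t < h → ∀ n : ℤ, t + c.im ≠ n := by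
    intro t ht ht' n hn
    obtain ⟨z, hz, e⟩ := hleaf t ht ht' 0 n (by simpa using hn)
    exact (f ⟨Φ z, hS' z hz⟩).base_ne_zero e
  have hnev : ∀ t, 0 < t → t < h → ∀ n : ℤ, t + (c.im - v.im) ≠ n := by
    intro t ht ht' n hn
    obtain ⟨z, hz, e⟩ := hleaf t ht ht' v n hn
    exact (f ⟨Φ z, hS' z hz⟩).base_ne e
  -- normalize the lift so that it has heights in `(0, 1)`
  set m : ℤ := ⌊h / 2 + c.im⌋
  set κ : ℤ := m - ⌊h / 2 + (c.im - v.im)⌋ with hκ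
  have hband : ∀ z ∈ strip h, z + (c - m * Complex.I) ∈ band v κ := by
    rintro z ⟨hz, hz'⟩
    have him : (z + (c - m * Complex.I)).im = z.im + c.im - m := by simp; ring
    have e1 : ⌊z.im + c.im⌋ = m :=
      floor_add_eq_of_forall_ne hne0 hz hz' (by linarith) (by linarith)
    have e2 : ⌊z.im + (c.im - v.im)⌋ = m - κ := by
      rw [hκ, sub_sub_cancel]
      exact floor_add_eq_of_forall_ne hnev hz hz' (by linarith) (by linarith)
    have l1 := ((Int.floor_eq_iff.1 e1).1).lt_of_ne (hne0 _ hz hz' _).symm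
    have l2 := (Int.floor_eq_iff.1 e2).1.lt_of_ne (hnev _ hz hz' _).symm
    have r1 := (Int.floor_eq_iff.1 e1).2
    have r2 := (Int.floor_eq_iff.1 e2).2
    push_cast at l2 r2
    simp only [band, Set.mem_ofPred_eq, him]
    refine ⟨?_, ?_, ?_, ?_⟩ <;> linarith
  have hpt : ∀ z ∈ strip h, ∃ k : ZMod d, Φ z ∈ bandCylinder f κ k := by
    intro z hz
    obtain ⟨k, hk⟩ := exists_bandLift_eq (x := f ⟨Φ z, hS' z hz⟩) (hband z hz) (by
      rw [hbase z hz]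
      exact toTorus_eq_iff.2 ⟨0, -m, by push_cast; ring⟩)
    refine ⟨k, _, hband z hz, ?_⟩
    rw [bandMap_of_mem f k (hband z hz), hk, f.symm_apply_apply]
  have hz₀ : (⟨0, h / 2⟩ : ℂ) ∈ strip h := ⟨half_pos hh, half_lt_self hh⟩
  obtain ⟨k₀, hk₀⟩ := hpt _ hz₀
  refine ⟨κ, k₀, ⟨_, hband _ hz₀⟩, ?_⟩
  -- the image is connected, and the cylinders over the band are open and pairwise disjoint
  refine IsPreconnected.subset_left_of_subset_union (isOpen_bandCylinder f k₀)
    (v := ⋃ k ∈ {k : ZMod d | k₀ - k ∉ AddSubgroup.zmultiples (κ : ZMod d)}, bandCylinder f κ k)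
    (isOpen_biUnion fun k _ => isOpen_bandCylinder f k) ?_ ?_ ⟨_, ⟨_, hz₀, rfl⟩, hk₀⟩
    (hconn.image Φ hΦ.continuousOn)
  · rw [Set.disjoint_left]
    intro x hx hx'
    obtain ⟨k, hk, hxk⟩ := Set.mem_iUnion₂.1 hx'
    exact hk (eq_and_sub_mem_of_mem_bandCylinder hf hx hxk).2
  · rintro _ ⟨z, hz, rfl⟩
    obtain ⟨k, hk⟩ := hpt z hz
    by_cases hkk : k₀ - k ∈ AddSubgroup.zmultiples (κ : ZMod d)
    · exact Or.inl (bandCylinder_congr f hkk ▸ hk)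
    · exact Or.inr (Set.mem_iUnion₂.2 ⟨k, hkk, hk⟩)

lemma isMaxCylinder_bandCylinder [T1Space X] (hd : 1 ≤ d) (hf : ∀ x, (f x).base = π x)
    (hπ : IsPullback ω π) (hω : ∀ x, x ≠ p₀ → x ≠ p₁ → ω x ≠ 0) (hκ : (band v κ).Nonempty)
    (k : ZMod d) :
    IsMaxCylinder ω {p₀, p₁} ((d : ℝ) / (Int.gcd κ d : ℝ)) (bandCylinder f κ k) := by
  have hw : (addOrderOf (κ : ZMod d) : ℝ) = (d : ℝ) / (Int.gcd κ d : ℝ) := by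
    rw [addOrderOf_intCast hd, Nat.cast_div_charZero]
    exact_mod_cast Int.gcd_dvd_right κ d
  refine ⟨hw ▸ isCylinder_bandCylinder hd hf hπ hω hκ k, fun w' C' hC' hsub => ?_⟩
  obtain ⟨κ', k', -, hC⟩ := hC'.subset_bandCylinder hf hπ
  refine Set.Subset.antisymm ?_ hsub
  rw [eq_of_bandCylinder_subset hf hκ (hsub.trans hC)]
  exact hC

lemma mem_horizontalCylinders_iff [T1Space X] (hd : 1 ≤ d) (hf : ∀ x, (f x).base = π x)
    (hπ : IsPullback ω π) (hω : ∀ x, x ≠ p₀ → x ≠ p₁ → ω x ≠ 0) {C : Set X} :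
    C ∈ horizontalCylinders ω {p₀, p₁} ↔
      ∃ κ : ℤ, (band v κ).Nonempty ∧ C ∈ Set.range (bandCylinder f κ) := by
  constructor
  · rintro ⟨w, hC, hmax⟩
    obtain ⟨κ, k, hκ, hsub⟩ := hC.subset_bandCylinder hf hπ
    exact ⟨κ, hκ, k, hmax _ _ (isCylinder_bandCylinder hd hf hπ hω hκ k) hsub⟩
  · rintro ⟨κ, hκ, k, rfl⟩
    exact ⟨_, isMaxCylinder_bandCylinder hd hf hπ hω hκ k⟩

end Classification

lemma band_nonempty_iff_of_mem_Ioo {v : ℂ} {i κ : ℤ} (h0 : (i : ℝ) < v.im) (h1 : v.im < i + 1) :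
    (band v κ).Nonempty ↔ κ = i ∨ κ = i + 1 := by
  constructor
  · rintro ⟨z, a, b, a', b'⟩
    have e : i - 1 < κ := by
      exact_mod_cast (by push_cast; linarith : ((i - 1 : ℤ) : ℝ) < κ)
    have g : κ < i + 2 := by
      exact_mod_cast (by push_cast; linarith : (κ : ℝ) < ((i + 2 : ℤ) : ℝ))
    omega
  · rintro (rfl | rfl)
    · refine ⟨⟨0, (v.im - κ + 1) / 2⟩, ?_⟩
      simp only [band, Set.mem_ofPred_eq]
      refine ⟨?_, ?_, ?_, ?_⟩ <;> linarith
    · refine ⟨⟨0, (v.im - i) / 2⟩, ?_⟩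
      simp only [band, Set.mem_ofPred_eq]
      push_cast
      refine ⟨?_, ?_, ?_, ?_⟩ <;> linarith

lemma band_nonempty_iff_of_im_eq {v : ℂ} {i κ : ℤ} (h : v.im = i) :
    (band v κ).Nonempty ↔ κ = i := by
  constructor
  · rintro ⟨z, a, b, a', b'⟩
    have e : i - 1 < κ := by
      exact_mod_cast (by push_cast; linarith : ((i - 1 : ℤ) : ℝ) < κ)
    have g : κ < i + 1 := by
      exact_mod_cast (by push_cast; linarith : (κ : ℝ) < ((i + 1 : ℤ) : ℝ))
    omega
  · rintro rfl
    refine ⟨⟨0, 1 / 2⟩, ?_⟩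
    simp only [band, Set.mem_ofPred_eq]
    refine ⟨?_, ?_, ?_, ?_⟩ <;> linarith

end DSym

theorem mainTheorem6 {X : Type*} [TopologicalSpace X] [T2Space X] [CompactSpace X]
    [ConnectedSpace X] [ChartedSpace ℂ X] [IsManifold (modelWithCornersSelf ℂ ℂ) 1 X]
    (d : ℕ) (hd : 1 ≤ d) (ω : DSym.OneForm X) (p₀ p₁ : X)
    (hX : DSym.IsDSymmetric d ω p₀ p₁) (i : ℤ) :
    (DSym.InFiberCylinder d i ω p₀ p₁ →
      ∃ A B : Set (Set X), Disjoint A B ∧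
        DSym.horizontalCylinders ω {p₀, p₁} = A ∪ B ∧
        A.encard = (Int.gcd i d : ℕ∞) ∧
        (∀ C ∈ A, DSym.IsMaxCylinder ω {p₀, p₁} ((d : ℝ) / (Int.gcd i d : ℝ)) C) ∧
        B.encard = (Int.gcd (i + 1) d : ℕ∞) ∧
        (∀ C ∈ B, DSym.IsMaxCylinder ω {p₀, p₁} ((d : ℝ) / (Int.gcd (i + 1) d : ℝ)) C)) ∧
    (DSym.InFiberCylinderBottom d i ω p₀ p₁ →
      (DSym.horizontalCylinders ω {p₀, p₁}).encard = (Int.gcd i d : ℕ∞) ∧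
      ∀ C ∈ DSym.horizontalCylinders ω {p₀, p₁},
        DSym.IsMaxCylinder ω {p₀, p₁} ((d : ℝ) / (Int.gcd i d : ℝ)) C) := by
  constructor
  · rintro ⟨v, h0, h1, -, π, ⟨hπ, -⟩, -, f, hf⟩
    have hband := fun κ => DSym.band_nonempty_iff_of_mem_Ioo (κ := κ) h0 h1
    have hi := (hband i).2 (Or.inl rfl)
    have hi1 := (hband (i + 1)).2 (Or.inr rfl)
    refine ⟨Set.range (DSym.bandCylinder f i), Set.range (DSym.bandCylinder f (i + 1)),
      ?_, ?_, ?_, ?_, ?_, ?_⟩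
    · rw [Set.disjoint_left]
      rintro _ ⟨k, rfl⟩ ⟨k', hk'⟩
      obtain ⟨z, hz⟩ := hi
      have hx : DSym.bandMap f i k z ∈ DSym.bandCylinder f i k := ⟨z, hz, rfl⟩
      have := (DSym.eq_and_sub_mem_of_mem_bandCylinder hf hx (hk' ▸ hx)).1
      omega
    · ext C
      simp only [DSym.mem_horizontalCylinders_iff hd hf hπ hX.ne_zero, hband, Set.mem_union,
        or_and_right, exists_or, exists_eq_left]
    · rw [DSym.encard_range_bandCylinder hd hf hi, DSym.index_zmultiples_intCast hd]
    · rintro _ ⟨k, rfl⟩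
      exact DSym.isMaxCylinder_bandCylinder hd hf hπ hX.ne_zero hi k
    · rw [DSym.encard_range_bandCylinder hd hf hi1, DSym.index_zmultiples_intCast hd]
    · rintro _ ⟨k, rfl⟩
      exact DSym.isMaxCylinder_bandCylinder hd hf hπ hX.ne_zero hi1 k
  · rintro ⟨v, h0, -, π, ⟨hπ, -⟩, -, f, hf⟩
    have hband := fun κ => DSym.band_nonempty_iff_of_im_eq (κ := κ) h0
    have hi := (hband i).2 rfl
    have hcyl : DSym.horizontalCylinders ω {p₀, p₁} = Set.range (DSym.bandCylinder f i) := by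
      ext C
      simp only [DSym.mem_horizontalCylinders_iff hd hf hπ hX.ne_zero, hband, exists_eq_left]
    rw [hcyl]
    refine ⟨?_, ?_⟩
    · rw [DSym.encard_range_bandCylinder hd hf hi, DSym.index_zmultiples_intCast hd]
    · rintro _ ⟨k, rfl⟩
      exact DSym.isMaxCylinder_bandCylinder hd hf hπ hX.ne_zero hi k
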